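/- Let $\psi(a)=\left(\frac{a}{7}\right)\in\{0,1,-1\}$ be the Legendre symbol modulo $7$, let $M=(M_{i,j})_{i,j\ge 0}$ be the integer matrix $M_{i,j}=\psi\left(\binom{i+j}{i}\right)$, and for an infinite matrix $N$ let $N(n)=(N_{i,j})_{0\le i,j<n}$. For $n\in\mathbf N$ let $\nu_i(n)\in\{0,\dots,6\}$, $i\ge 0$, be its base-$7$ digits, $n=\sum_i \nu_i(n)7^i$. An infinite matrix $N$ over a commutative ring is called $7$-self-similar if $N_{0,0}=1$ and $N_{s,t}=\prod_i N_{\nu_i(s),\nu_i(t)}$ for all $s,t\ge 0$; its defining matrix is $\tilde N=N(7)$. It is non-degenerate (over a field) if $N(1),\dots,N(7)$ are all invertible; one then puts $d(0)=1$ and $d(k)=\det N(k+1)/\det N(k)$ for $1\le k\le 6$. The matrix $M$ is $7$-self-similar, but it is degenerate, even over $\mathbf Q$. Let $P$ be the infinite matrix over $\mathbf Z[t]$ with $P_{s,u}=\prod_i\tilde P_{\nu_i(s),\nu_i(u)}$, where $$\tilde P=\begin{pmatrix} 1&1&1&1&1&1&1\\ 1&t+1&-1&1&-1&-1&0\\ 1&-1&-1&-1&1&0&0\\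 1&1&-1&-1&0&0&0\\ 1&-1&1&0&0&0&0\\ 1&-1&0&0&0&0&0\\ 1&0&0&0&0&0&0\end{pmatrix}.$$ Then: 1. $P$ is $7$-self-similar with defining matrix $\tilde P$, it becomes $M$ when $t=0$, and it is non-degenerate over the fraction field $\mathbf Q(t)$ of $\mathbf Z[t]$. 2. $\tilde P=\tilde L\tilde D\tilde L^{t}$ (with $\tilde L^{t}$ the transpose), where $\tilde L$ is the unipotent lower triangular matrix $$\tilde L=\begin{pmatrix} 1&0&0&0&0&0&0\\ 1&1&0&0&0&0&0\\ 1&\frac{-2}{t}&1&0&0&0&0\\ 1&0&\frac{t}{t+2}&1&0&0&0\\ 1&\frac{-2}{t}&\frac{2}{t+2}&\frac{t-2}{4}&1&0&0\\ 1&\frac{-2}{t}&\frac{t+4}{2t+4}&\frac{-1}{2}&\frac{-6}{t-10}&1&0\\ 1&\frac{-1}{t}&\frac12&0&\frac{-4}{t-10}&\frac{t+2}{t+8}&1\end{pmatrix}$$ and $\tilde D$ is the diagonal matrix whose diagonal entries are the numbers $d(0),\dots,d(6)$ of $P$, and these are $$d(0)=1,\quad d(1)=t,\quad d(2)=\frac{-2t-4}{t},\quad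 d(3)=\frac{-4}{t+2},\quad d(4)=\frac{t-10}{4},\quad d(5)=\frac{-t-8}{2t-20},\quad d(6)=\frac{-1}{t+8}.$$ 3. For every $n\ge 0$, $\det P(n)=\prod_{k=0}^{n-1}\prod_i d(\nu_i(k))$ in $\mathbf Q(t)$; in particular this rational function lies in $\mathbf Z[t]$, and its value at $t=0$ is $\det M(n)$. 4. For every $n\ge 0$, $\det M(n)$ is either $0$ or of the form $\pm 2^{\alpha}5^{\beta}$ with integers $\alpha,\beta\ge 0$. 5. For every $n\ge 1$, writing $m=n-1=\sum_i\mu_i7^i$ with $0\le\mu_i\le 6$, one has $\det M(n)=0$ if and only if either $\mu_i=1$ for some $i$, or there are $i>j$ with $\mu_i=2$ and $\mu_j\ne 6$. -/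

import Mathlib

open Polynomial

noncomputable section

namespace SelfSimilar

/-- The digit of `b ^ i` in the base `b` expansion of `n`. -/
def digit (b n i : ℕ) : ℕ := n / b ^ i % b

/-- An infinite matrix is `b`-self-similar if `M 0 0 = 1` and `M s t` is the product of the entries
indexed by the pairs of base `b` digits of `s` and `t`. (Since `M 0 0 = 1` and `b ≥ 2`, only
finitely many factors differ from `1`.) -/
def IsSelfSimilar {R : Type*} [CommRing R] (b : ℕ) (M : Matrix ℕ ℕ R) : Prop :=
  M 0 0 = 1 ∧ ∀ s t : ℕ, M s t = ∏ᶠ i : ℕ, M (digit b s i) (digit b t i)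

/-- The finite matrix `M(n) = (M i j)` with `0 ≤ i, j < n`. -/
def trunc {R : Type*} (M : Matrix ℕ ℕ R) (n : ℕ) : Matrix (Fin n) (Fin n) R :=
  Matrix.of fun i j => M i j

/-- The infinite matrix with defining matrix `A`; it is `b`-self-similar when `A 0 0 = 1`. -/
def ofDefining {R : Type*} [CommRing R] (b : ℕ) [NeZero b] (A : Matrix (Fin b) (Fin b) R) :
    Matrix ℕ ℕ R :=
  Matrix.of fun s t => ∏ᶠ i : ℕ, A (Fin.ofNat b (digit b s i)) (Fin.ofNat b (digit b t i))

/-- The matrices `M(1), …, M(b)` are all invertible. -/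
def IsNondegenerate {R : Type*} [CommRing R] (b : ℕ) (M : Matrix ℕ ℕ R) : Prop :=
  ∀ k : ℕ, 1 ≤ k → k ≤ b → IsUnit (trunc M k)

/-- `d(0) = 1` and `d(k) = det M(k+1) / det M(k)` for `k ≥ 1`. -/
def pivot {K : Type*} [Field K] (M : Matrix ℕ ℕ K) (k : ℕ) : K :=
  if k = 0 then 1 else (trunc M (k + 1)).det / (trunc M k).det

/-- The integer matrix of Legendre symbols of the binomial coefficients `(i + j).choose i`. -/
def legendrePascal (p : ℕ) [Fact p.Prime] : Matrix ℕ ℕ ℤ :=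
  Matrix.of fun i j => legendreSym p (((i + j).choose i : ℕ) : ℤ)

instance factPrimeSeven : Fact (Nat.Prime 7) := ⟨by norm_num⟩

/-- The perturbed defining matrix over `ℤ[t]` (with `t = X`). -/
def pertDefining : Matrix (Fin 7) (Fin 7) ℤ[X] :=
  !![1, 1, 1, 1, 1, 1, 1;
     1, X + 1, -1, 1, -1, -1, 0;
     1, -1, -1, -1, 1, 0, 0;
     1, 1, -1, -1, 0, 0, 0;
     1, -1, 1, 0, 0, 0, 0;
     1, -1, 0, 0, 0, 0, 0;
     1, 0, 0, 0, 0, 0, 0]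

/-- The infinite matrix over `ℤ[t]` defined by `pertDefining`. -/
def pert : Matrix ℕ ℕ ℤ[X] := ofDefining 7 pertDefining

/-- The matrix `pert` over the field `RatFunc ℤ`, the fraction field of `ℤ[t]`. -/
def pertFrac : Matrix ℕ ℕ (RatFunc ℤ) := pert.map (algebraMap ℤ[X] (RatFunc ℤ))

/-- The variable `t` in the fraction field of `ℤ[t]`. -/
abbrev t : RatFunc ℤ := RatFunc.X

/-- The explicit unipotent lower triangular factor. -/
def pertL : Matrix (Fin 7) (Fin 7) (RatFunc ℤ) :=
  !![1, 0, 0, 0, 0, 0, 0;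
     1, 1, 0, 0, 0, 0, 0;
     1, -2 / t, 1, 0, 0, 0, 0;
     1, 0, t / (t + 2), 1, 0, 0, 0;
     1, -2 / t, 2 / (t + 2), (t - 2) / 4, 1, 0, 0;
     1, -2 / t, (t + 4) / (2 * t + 4), -1 / 2, -6 / (t - 10), 1, 0;
     1, -1 / t, 1 / 2, 0, -4 / (t - 10), (t + 2) / (t + 8), 1]

/-- The explicit values `d(0), …, d(6)`. -/
def pertD : Fin 7 → RatFunc ℤ :=
  ![1, t, (-2 * t - 4) / t, -4 / (t + 2), (t - 10) / 4, (-t - 8) / (2 * t - 20), -1 / (t + 8)]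

end SelfSimilar

end

noncomputable section

namespace SelfSimilar

/-! ### Self-similar matrices -/

/-! A factorization `A = L * diagonal D * Lᵗ` of a defining matrix passes to the infinite matrices,
because a sum over `r < b ^ N` is a sum over `N` independent digits (`ofDefining_eq_sum`). As `L` is
unipotent lower triangular, the factorization survives truncation to any size `n`, so the
determinant is the product of the digitwise pivots (`det_trunc_ofDefining`).

Lucas's theorem makes `legendrePascal` self-similar, so it is the value of `pert` at `t = 0`. The
pivots have order 0 at `t = 0`, except `d(1)` (order 1) and `d(2)` (order -1), and their leading
coefficients involve only the primes 2 and 5. Hence the determinant at `t = 0` vanishes when the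
total order `detOrder` is positive, and otherwise divides some `±2^α 5^β`. The order is never
negative; the recursion `detOrder_seven_mul_add` expresses it through shorter base 7 expansions, and
the vanishing criterion follows by induction on it. -/

theorem digit_zero (b n : ℕ) : digit b n 0 = n % b := by simp [digit]

theorem digit_succ (b n i : ℕ) : digit b n (i + 1) = digit b (n / b) i := by
  simp [digit, pow_succ', Nat.div_div_eq_div_mul]

theorem digit_eq_zero {b n i : ℕ} (h : n < b ^ i) : digit b n i = 0 := by
  simp [digit, Nat.div_eq_of_lt h]

theorem digit_eq_zero_of_le {b n i : ℕ} (hb : 1 < b) (h : n ≤ i) : digit b n i = 0 :=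
  digit_eq_zero (h.trans_lt (Nat.lt_pow_self hb))

/-- The bound `N` makes the multiplicative support finite; on an infinite support `finprod` takes
the default value 1 and the factor `f 0` could not be split off. -/
theorem finprod_eq_mul_finprod_succ {R : Type*} [CommMonoid R] (f : ℕ → R) (N : ℕ)
    (hf : ∀ i, N ≤ i → f i = 1) : ∏ᶠ i, f i = f 0 * ∏ᶠ i, f (i + 1) := by
  rw [finprod_eq_prod_of_mulSupport_subset f (s := Finset.range (N + 1)),
    finprod_eq_prod_of_mulSupport_subset _ (s := Finset.range N), Finset.prod_range_succ', mul_comm]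
  · intro i hi
    by_contra h
    exact hi (hf _ (by simp at h; omega))
  · intro i hi
    by_contra h
    exact hi (hf _ (by simp at h; omega))

section Recursion

variable {R : Type*} [CommRing R] {b : ℕ}

theorem ofDefining_apply [NeZero b] (A : Matrix (Fin b) (Fin b) R) (s t : ℕ) :
    ofDefining b A s t =
      ∏ᶠ i : ℕ, A (Fin.ofNat b (digit b s i)) (Fin.ofNat b (digit b t i)) := rfl

theorem finprod_digit_zero (f : ℕ → R) (h0 : f 0 = 1) :
    ∏ᶠ i, f (digit b 0 i) = 1 := by
  simp [digit, h0]

theorem finprod_digit_rec (hb : 1 < b) (f : ℕ → R) (h0 : f 0 = 1) (k : ℕ) :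
    ∏ᶠ i, f (digit b k i) = f (k % b) * ∏ᶠ i, f (digit b (k / b) i) := by
  rw [finprod_eq_mul_finprod_succ _ k]
  · simp only [digit_zero, digit_succ]
  · intro i hi
    rw [digit_eq_zero_of_le hb hi, h0]

theorem ofDefining_zero [NeZero b] (A : Matrix (Fin b) (Fin b) R) (h0 : A 0 0 = 1) :
    ofDefining b A 0 0 = 1 := by
  simp [ofDefining_apply, digit, h0]

theorem ofDefining_rec [NeZero b] (hb : 1 < b) (A : Matrix (Fin b) (Fin b) R) (h0 : A 0 0 = 1)
    (s t : ℕ) :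
    ofDefining b A s t =
      A (Fin.ofNat b s) (Fin.ofNat b t) * ofDefining b A (s / b) (t / b) := by
  have hm (n : ℕ) : Fin.ofNat b (n % b) = Fin.ofNat b n := by ext; simp
  rw [ofDefining_apply, finprod_eq_mul_finprod_succ _ (max s t)]
  · simp only [digit_zero, digit_succ, hm, ofDefining_apply]
  · intro i hi
    rw [digit_eq_zero_of_le hb (le_of_max_le_left hi), digit_eq_zero_of_le hb (le_of_max_le_right hi)]
    exact h0

theorem ofDefining_of_lt [NeZero b] (hb : 1 < b) (A : Matrix (Fin b) (Fin b) R) (h0 : A 0 0 = 1)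
    {s t : ℕ} (hs : s < b) (ht : t < b) :
    ofDefining b A s t = A (Fin.ofNat b s) (Fin.ofNat b t) := by
  rw [ofDefining_rec hb A h0, Nat.div_eq_of_lt hs, Nat.div_eq_of_lt ht, ofDefining_zero A h0, mul_one]

theorem digit_lt (hb : 0 < b) (n i : ℕ) : digit b n i < b := Nat.mod_lt _ hb

theorem isSelfSimilar_ofDefining [NeZero b] (hb : 1 < b) (A : Matrix (Fin b) (Fin b) R)
    (h0 : A 0 0 = 1) : IsSelfSimilar b (ofDefining b A) := by
  refine ⟨ofDefining_zero A h0, fun s t => ?_⟩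
  rw [ofDefining_apply]
  refine finprod_congr fun i => ?_
  rw [ofDefining_of_lt hb A h0 (digit_lt (by omega) _ _) (digit_lt (by omega) _ _)]

theorem trunc_ofDefining [NeZero b] (hb : 1 < b) (A : Matrix (Fin b) (Fin b) R)
    (h0 : A 0 0 = 1) : trunc (ofDefining b A) b = A := by
  ext i j
  simp [trunc, ofDefining_of_lt hb A h0 i.2 j.2]

theorem isSelfSimilar_of_rec (hb : 1 < b) (M : Matrix ℕ ℕ R) (h0 : M 0 0 = 1)
    (h : ∀ s t, M s t = M (s % b) (t % b) * M (s / b) (t / b)) : IsSelfSimilar b M := by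
  refine ⟨h0, fun s => ?_⟩
  -- Both indices are placed below one power of `b`, so that a single induction on the number of
  -- digits treats them together.
  suffices H : ∀ N s t : ℕ, s < b ^ N → t < b ^ N →
      M s t = ∏ᶠ i : ℕ, M (digit b s i) (digit b t i) from fun t =>
    H (max s t) s t ((le_max_left s t).trans_lt (Nat.lt_pow_self hb))
      ((le_max_right s t).trans_lt (Nat.lt_pow_self hb))
  intro N
  induction N with
  | zero =>
    intro s t hs ht
    obtain rfl : s = 0 := by simpa using hs
    obtain rfl : t = 0 := by simpa using ht
    simp [digit, h0]
  | succ N ih =>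
    intro s t hs ht
    rw [h, ih (s / b) (t / b) (Nat.div_lt_of_lt_mul (by rwa [← pow_succ']))
      (Nat.div_lt_of_lt_mul (by rwa [← pow_succ'])),
      finprod_eq_mul_finprod_succ (fun i => M (digit b s i) (digit b t i)) (max s t)]
    · simp only [digit_zero, digit_succ]
    · intro i hi
      rw [digit_eq_zero_of_le hb (le_of_max_le_left hi),
        digit_eq_zero_of_le hb (le_of_max_le_right hi), h0]

/-- Order is lexicographic in the digits: either the quotients by `b` are already in strict order,
or they agree and the last digits are. -/
theorem ofDefining_eq_zero_of_lt [NeZero b] (hb : 1 < b) (A : Matrix (Fin b) (Fin b) R)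
    (h0 : A 0 0 = 1) (hA : ∀ i j, i < j → A i j = 0) (s t : ℕ) (hst : s < t) :
    ofDefining b A s t = 0 := by
  induction t using Nat.strong_induction_on generalizing s with
  | _ t ih =>
    rw [ofDefining_rec hb A h0]
    rcases lt_or_ge (s / b) (t / b) with h | h
    · rw [ih (t / b) (Nat.div_lt_self (by omega) hb) _ h, mul_zero]
    · have h' : s / b = t / b := le_antisymm (Nat.div_le_div_right hst.le) h
      rw [hA, zero_mul]
      simp only [Fin.lt_def, Fin.val_ofNat]
      have h1 := Nat.div_add_mod s b
      have h2 := Nat.div_add_mod t b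
      rw [h'] at h1
      omega

theorem ofDefining_diag [NeZero b] (A : Matrix (Fin b) (Fin b) R) (hA : ∀ i, A i i = 1) (s : ℕ) :
    ofDefining b A s s = 1 := by
  simp [ofDefining_apply, hA]

theorem ofDefining_map [NeZero b] {S : Type*} [CommRing S] (hb : 1 < b)
    (A : Matrix (Fin b) (Fin b) R) (h0 : A 0 0 = 1) (f : R →+* S) :
    (ofDefining b A).map f = ofDefining b (A.map f) := by
  ext s t
  rw [Matrix.map_apply, ofDefining_apply, ofDefining_apply]
  refine (f : R →* S).map_finprod (Set.Finite.subset (Finset.range (max s t)).finite_toSet ?_)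
  intro i hi
  by_contra h
  simp only [Finset.coe_range, Set.mem_Iio, not_lt] at h
  refine hi ?_
  dsimp only
  rw [digit_eq_zero_of_le hb (le_of_max_le_left h), digit_eq_zero_of_le hb (le_of_max_le_right h)]
  exact h0

theorem sum_range_mul_eq (g : ℕ → R) (N : ℕ) :
    ∑ r ∈ Finset.range (b * N), g r =
      ∑ q ∈ Finset.range N, ∑ a ∈ Finset.range b, g (b * q + a) := by
  induction N with
  | zero => simp
  | succ N ih => rw [Nat.mul_succ, Finset.sum_range_add, ih, Finset.sum_range_succ]

theorem ofDefining_eq_sum [NeZero b] (hb : 1 < b) {A L : Matrix (Fin b) (Fin b) R}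
    {D : Fin b → R} (hA0 : A 0 0 = 1) (hL0 : L 0 0 = 1) (hD0 : D 0 = 1)
    (h : A = L * Matrix.diagonal D * L.transpose) (N s t : ℕ) (hs : s < b ^ N) (ht : t < b ^ N) :
    ofDefining b A s t = ∑ r ∈ Finset.range (b ^ N),
      ofDefining b L s r * (∏ᶠ i, D (Fin.ofNat b (digit b r i))) * ofDefining b L t r := by
  induction N generalizing s t with
  | zero =>
    obtain rfl : s = 0 := by simpa using hs
    obtain rfl : t = 0 := by simpa using ht
    simp only [pow_zero, Finset.range_one, Finset.sum_singleton, ofDefining_zero _ hA0,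
      ofDefining_zero _ hL0]
    simp [digit, hD0]
  | succ N ih =>
    have hA' (i j) : A i j = ∑ k : Fin b, L i k * D k * L j k := by
      rw [h, Matrix.mul_apply]
      simp [Matrix.mul_diagonal]
    rw [ofDefining_rec hb A hA0, ih _ _ (Nat.div_lt_of_lt_mul (by rwa [← pow_succ']))
      (Nat.div_lt_of_lt_mul (by rwa [← pow_succ'])), hA', pow_succ', sum_range_mul_eq,
      mul_comm, Finset.sum_mul]
    refine Finset.sum_congr rfl fun q _ => ?_
    rw [Finset.mul_sum, Finset.sum_range]
    refine Finset.sum_congr rfl fun a _ => ?_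
    have h1 : (b * q + (a : ℕ)) / b = q := by
      rw [Nat.mul_add_div (by omega), Nat.div_eq_of_lt a.2, add_zero]
    have h2 : Fin.ofNat b (b * q + (a : ℕ)) = a := by
      ext; simp [Nat.mod_eq_of_lt a.2]
    have h3 : (b * q + (a : ℕ)) % b = a := by
      simp [Nat.mod_eq_of_lt a.2]
    rw [ofDefining_rec hb L hL0 s, ofDefining_rec hb L hL0 t,
      finprod_digit_rec hb (fun n => D (Fin.ofNat b n)) (by exact hD0) (b * q + a), h1, h2, h3]
    have h4 : Fin.ofNat b (a : ℕ) = a := by ext; simp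
    rw [h4]
    ring

theorem det_trunc_ofDefining [NeZero b] (hb : 1 < b) {A L : Matrix (Fin b) (Fin b) R}
    {D : Fin b → R} (hA0 : A 0 0 = 1) (hL : ∀ i, L i i = 1) (hL' : ∀ i j, i < j → L i j = 0)
    (hD0 : D 0 = 1) (h : A = L * Matrix.diagonal D * L.transpose) (n : ℕ) :
    (trunc (ofDefining b A) n).det =
      ∏ k ∈ Finset.range n, ∏ᶠ i, D (Fin.ofNat b (digit b k i)) := by
  have key : trunc (ofDefining b A) n = trunc (ofDefining b L) n *
      Matrix.diagonal (fun k : Fin n => ∏ᶠ i, D (Fin.ofNat b (digit b k i))) *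
      (trunc (ofDefining b L) n).transpose := by
    ext i j
    have hn : n < b ^ n := Nat.lt_pow_self hb
    rw [Matrix.mul_apply]
    simp only [Matrix.mul_diagonal, trunc, Matrix.of_apply, Matrix.transpose_apply]
    rw [ofDefining_eq_sum hb hA0 (hL 0) hD0 h n i j (i.2.trans hn) (j.2.trans hn),
      -- The terms with `n ≤ r < b ^ n` vanish, since `L i r = 0` for `i < r`.
      ← Finset.sum_subset (Finset.range_subset_range.2 hn.le), Finset.sum_range]
    intro r _ hr
    rw [ofDefining_eq_zero_of_lt hb L (hL 0) hL' i r (by have := i.2; simp at hr; omega)]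
    simp
  have hdet : (trunc (ofDefining b L) n).det = 1 := by
    rw [Matrix.det_of_isLowerTriangular (M := trunc (ofDefining b L) n) fun i j hij =>
      ofDefining_eq_zero_of_lt hb L (hL 0) hL' i j hij]
    exact Finset.prod_eq_one fun i _ => ofDefining_diag L hL i
  rw [key, Matrix.det_mul, Matrix.det_mul, Matrix.det_transpose, hdet, Matrix.det_diagonal,
    Finset.prod_range]
  simp

end Recursion

/-! ### The factorization of the defining matrix -/

theorem algebraMap_ne_zero_of_eval {p : ℤ[X]} (a : ℤ) (h : p.eval a ≠ 0) :
    algebraMap ℤ[X] (RatFunc ℤ) p ≠ 0 := by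
  intro h0
  refine h ?_
  rw [(map_eq_zero_iff _ (RatFunc.algebraMap_injective ℤ)).1 h0, eval_zero]

theorem t_add_intCast_ne_zero (c : ℤ) : t + (c : RatFunc ℤ) ≠ 0 := by
  -- `X + c` takes the value 1 at `1 - c`.
  have := algebraMap_ne_zero_of_eval (p := X + C c) (1 - c) (by simp)
  simpa using this

instance charZeroRatFuncInt : CharZero (RatFunc ℤ) :=
  charZero_of_injective_algebraMap (RatFunc.algebraMap_injective ℤ)

theorem t_ne_zero : t ≠ 0 := by simpa using t_add_intCast_ne_zero 0

theorem t_add_two_ne_zero : t + 2 ≠ 0 := by simpa using t_add_intCast_ne_zero 2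

theorem t_add_eight_ne_zero : t + 8 ≠ 0 := by simpa using t_add_intCast_ne_zero 8

theorem t_sub_ten_ne_zero : t - 10 ≠ 0 := by
  simpa [sub_eq_add_neg] using t_add_intCast_ne_zero (-10)

theorem pertL_diag (i : Fin 7) : pertL i i = 1 := by
  fin_cases i <;> rfl

theorem pertL_eq_zero_of_lt (i j : Fin 7) (h : i < j) : pertL i j = 0 := by
  fin_cases i <;> fin_cases j <;> first | rfl | exact absurd h (by decide)

theorem pertDefining_map_eq :
    pertDefining.map (algebraMap ℤ[X] (RatFunc ℤ)) =
      pertL * Matrix.diagonal pertD * pertL.transpose := by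
  have h0 := t_ne_zero
  have h2 := t_add_two_ne_zero
  have h8 := t_add_eight_ne_zero
  have h10 := t_sub_ten_ne_zero
  have e1 : 2 * t + 4 = 2 * (t + 2) := by ring
  have e2 : 2 * t - 20 = 2 * (t - 10) := by ring
  ext i j
  rw [Matrix.mul_apply]
  simp only [Matrix.mul_diagonal, Matrix.transpose_apply, Fin.sum_univ_seven, Matrix.map_apply]
  fin_cases i <;> fin_cases j <;>
    simp [pertDefining, pertL, pertD, e1, e2] <;> field_simp <;> ring

/-! ### The matrix of Legendre symbols -/

theorem legendrePascal_apply (p : ℕ) [Fact p.Prime] (i j : ℕ) :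
    legendrePascal p i j = legendreSym p (((i + j).choose i : ℕ) : ℤ) := rfl

theorem legendreSym_natCast_congr (p : ℕ) [Fact p.Prime] {a b : ℕ} (h : a ≡ b [MOD p]) :
    legendreSym p (a : ℤ) = legendreSym p (b : ℤ) := by
  rw [legendreSym.mod p a, legendreSym.mod p b, ← Int.natCast_mod, ← Int.natCast_mod, h]

/-- Lucas's theorem gives this directly when the last digits add without carry. -/
theorem legendrePascal_rec (p : ℕ) [hp : Fact p.Prime] (i j : ℕ) :
    legendrePascal p i j = legendrePascal p (i % p) (j % p) * legendrePascal p (i / p) (j / p) := by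
  have hp0 := hp.out.pos
  simp only [legendrePascal_apply]
  rw [legendreSym_natCast_congr p Choose.choose_modEq_choose_mod_mul_choose_div_nat]
  rcases lt_or_ge (i % p + j % p) p with h | h
  · rw [Nat.cast_mul, legendreSym.mul, Nat.add_mod, Nat.mod_eq_of_lt h,
      Nat.add_div_eq_of_add_mod_lt h]
  -- With a carry both sides are 0: `p` divides the binomial coefficient of the last digits, and the
  -- last digit of `i + j` drops below that of `i`, which kills the Lucas factor.
  · have h1 : legendreSym p (((i % p + j % p).choose (i % p) : ℕ) : ℤ) = 0 := by
      rw [legendreSym.eq_zero_iff, Int.cast_natCast, ZMod.natCast_eq_zero_iff]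
      exact hp.out.dvd_choose_add (Nat.mod_lt _ hp0) (Nat.mod_lt _ hp0) h
    have h2 : (i + j) % p < i % p := by
      have := Nat.mod_lt j hp0
      have := Nat.mod_lt i hp0
      rw [Nat.add_mod, Nat.mod_eq_sub_mod h, Nat.mod_eq_of_lt] <;> omega
    rw [h1, Nat.choose_eq_zero_of_lt h2]
    simp

theorem isSelfSimilar_legendrePascal (p : ℕ) [hp : Fact p.Prime] :
    IsSelfSimilar p (legendrePascal p) :=
  isSelfSimilar_of_rec hp.out.one_lt _ (by simp [legendrePascal_apply]) (legendrePascal_rec p)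

theorem not_isNondegenerate_legendrePascal :
    ¬ IsNondegenerate 7 ((legendrePascal 7).map (Int.cast : ℤ → ℚ)) := by
  intro h
  have h2 := (Matrix.isUnit_iff_isUnit_det _).1 (h 2 (by norm_num) (by norm_num))
  have e (i j : ℕ) (hi : i < 2) (hj : j < 2) : legendrePascal 7 i j = 1 := by
    interval_cases i <;> interval_cases j <;> decide
  rw [Matrix.det_fin_two] at h2
  simp [trunc, e] at h2

/-! ### The perturbed matrix -/

theorem pertDefining_zero : pertDefining 0 0 = 1 := rfl

theorem isSelfSimilar_pert : IsSelfSimilar 7 pert :=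
  isSelfSimilar_ofDefining (by norm_num) _ pertDefining_zero

theorem trunc_pert : trunc pert 7 = pertDefining :=
  trunc_ofDefining (by norm_num) _ pertDefining_zero

theorem pertDefining_eval (i j : Fin 7) : (pertDefining i j).eval 0 = legendrePascal 7 i j := by
  rw [legendrePascal_apply]
  fin_cases i <;> fin_cases j <;> simp [pertDefining, Nat.choose] <;> norm_num

theorem pert_map_eval : pert.map (eval 0) = legendrePascal 7 := by
  have h := ofDefining_map (by norm_num) pertDefining pertDefining_zero (evalRingHom (0 : ℤ))
  rw [coe_evalRingHom] at h
  rw [pert, h]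
  ext s t
  rw [(isSelfSimilar_legendrePascal 7).2 s t, ofDefining_apply]
  refine finprod_congr fun i => ?_
  rw [Matrix.map_apply, pertDefining_eval]
  simp [digit]

theorem det_trunc_map {R S : Type*} [CommRing R] [CommRing S] (f : R →+* S) (M : Matrix ℕ ℕ R)
    (n : ℕ) : (trunc (M.map f) n).det = f (trunc M n).det := by
  rw [RingHom.map_det]
  rfl

theorem det_trunc_legendrePascal (n : ℕ) :
    (trunc (legendrePascal 7) n).det = (trunc pert n).det.eval 0 := by
  rw [← pert_map_eval]
  exact det_trunc_map (evalRingHom (0 : ℤ)) pert n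

theorem algebraMap_det_trunc_pert (n : ℕ) :
    algebraMap ℤ[X] (RatFunc ℤ) (trunc pert n).det =
      ∏ k ∈ Finset.range n, ∏ᶠ i : ℕ, pertD (Fin.ofNat 7 (digit 7 k i)) := by
  rw [← det_trunc_map, pert, ofDefining_map (by norm_num) _ pertDefining_zero]
  exact det_trunc_ofDefining (by norm_num) (by simp [pertDefining_zero]) pertL_diag
    pertL_eq_zero_of_lt rfl pertDefining_map_eq n

theorem finprod_pertD_of_lt {k : ℕ} (hk : k < 7) :
    ∏ᶠ i : ℕ, pertD (Fin.ofNat 7 (digit 7 k i)) = pertD (Fin.ofNat 7 k) := by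
  rw [finprod_digit_rec (by norm_num) (fun n => pertD (Fin.ofNat 7 n)) rfl, Nat.div_eq_of_lt hk,
    finprod_digit_zero (fun n => pertD (Fin.ofNat 7 n)) rfl, Nat.mod_eq_of_lt hk, mul_one]

theorem det_trunc_pertFrac {n : ℕ} (hn : n ≤ 7) :
    (trunc pertFrac n).det = ∏ k ∈ Finset.range n, pertD (Fin.ofNat 7 k) := by
  rw [pertFrac, det_trunc_map, algebraMap_det_trunc_pert]
  exact Finset.prod_congr rfl fun k hk =>
    finprod_pertD_of_lt ((Finset.mem_range.1 hk).trans_le hn)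

theorem pertD_ne_zero (k : Fin 7) : pertD k ≠ 0 := by
  have h0 := t_ne_zero
  have h2 := t_add_two_ne_zero
  have h8 := t_add_eight_ne_zero
  have h10 := t_sub_ten_ne_zero
  have e1 : 2 * t - 20 = 2 * (t - 10) := by ring
  have e2 : -2 * t - 4 = -2 * (t + 2) := by ring
  have e3 : -t - 8 = -(t + 8) := by ring
  fin_cases k <;> simp only [pertD, e1, e2, e3] <;>
    simp [h0, h2, h8, h10, -neg_add_rev]

theorem det_trunc_pertFrac_ne_zero {n : ℕ} (hn : n ≤ 7) : (trunc pertFrac n).det ≠ 0 := by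
  rw [det_trunc_pertFrac hn]
  exact Finset.prod_ne_zero_iff.2 fun k _ => pertD_ne_zero _

theorem isNondegenerate_pertFrac : IsNondegenerate 7 pertFrac := fun _ _ hk =>
  (Matrix.isUnit_iff_isUnit_det _).2 (isUnit_iff_ne_zero.2 (det_trunc_pertFrac_ne_zero hk))

theorem pivot_pertFrac (k : Fin 7) : pivot pertFrac k = pertD k := by
  rw [pivot]
  split_ifs with h
  · obtain rfl : k = 0 := Fin.ext h
    rfl
  · rw [div_eq_iff (det_trunc_pertFrac_ne_zero k.2.le), det_trunc_pertFrac k.2,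
      Finset.prod_range_succ, ← det_trunc_pertFrac k.2.le, mul_comm]
    congr 2
    ext
    simp

/-! ### The order of vanishing at zero -/

/-- The integers whose only prime divisors are `2` and `5`. -/
def twoFive : Submonoid ℤ where
  carrier := {x | ∃ a b : ℕ, x.natAbs = 2 ^ a * 5 ^ b}
  one_mem' := ⟨0, 0, rfl⟩
  mul_mem' := by
    rintro x y ⟨a, b, h⟩ ⟨c, d, h'⟩
    exact ⟨a + c, b + d, by rw [Int.natAbs_mul, h, h']; ring⟩

theorem ne_zero_of_mem_twoFive {x : ℤ} (h : x ∈ twoFive) : x ≠ 0 := by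
  obtain ⟨a, b, h⟩ := h
  rintro rfl
  simp at h

theorem mem_twoFive_of_dvd {x y : ℤ} (hy : y ∈ twoFive) (h : x ∣ y) : x ∈ twoFive := by
  obtain ⟨a, b, hy⟩ := hy
  have h' := Int.natAbs_dvd_natAbs.2 h
  rw [hy, Nat.dvd_mul] at h'
  obtain ⟨c, d, hc, hd, h'⟩ := h'
  obtain ⟨α, -, rfl⟩ := (Nat.dvd_prime_pow Nat.prime_two).1 hc
  obtain ⟨β, -, rfl⟩ := (Nat.dvd_prime_pow Nat.prime_five).1 hd
  exact ⟨α, β, h'.symm⟩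

/-- `x` equals `X ^ e` times a quotient of polynomials whose values at `0` lie in `twoFive`. -/
def HasOrder (x : RatFunc ℤ) (e : ℤ) : Prop :=
  ∃ (B C : ℤ[X]) (a c : ℕ), B.eval 0 ∈ twoFive ∧ C.eval 0 ∈ twoFive ∧ e = a - c ∧
    x * algebraMap ℤ[X] (RatFunc ℤ) (B * X ^ c) = algebraMap ℤ[X] (RatFunc ℤ) (C * X ^ a)

theorem HasOrder.one : HasOrder 1 0 :=
  ⟨1, 1, 0, 0, by simp, by simp, by simp, by simp⟩

theorem HasOrder.mul {x y : RatFunc ℤ} {e f : ℤ} (hx : HasOrder x e) (hy : HasOrder y f) :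
    HasOrder (x * y) (e + f) := by
  obtain ⟨B, C, a, c, hB, hC, he, h⟩ := hx
  obtain ⟨B', C', a', c', hB', hC', he', h'⟩ := hy
  refine ⟨B * B', C * C', a + a', c + c', ?_, ?_, by rw [he, he']; push_cast; ring, ?_⟩
  · rw [eval_mul]; exact mul_mem hB hB'
  · rw [eval_mul]; exact mul_mem hC hC'
  · have e1 : B * B' * X ^ (c + c') = (B * X ^ c) * (B' * X ^ c') := by ring
    have e2 : C * C' * X ^ (a + a') = (C * X ^ a) * (C' * X ^ a') := by ring
    rw [e1, e2, map_mul _ (B * X ^ c), map_mul _ (C * X ^ a), ← h, ← h']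
    ring

theorem HasOrder.prod {ι : Type*} (s : Finset ι) {x : ι → RatFunc ℤ} {e : ι → ℤ}
    (h : ∀ i ∈ s, HasOrder (x i) (e i)) : HasOrder (∏ i ∈ s, x i) (∑ i ∈ s, e i) := by
  classical
  induction s using Finset.induction_on with
  | empty => simpa using HasOrder.one
  | insert i s hi ih =>
    rw [Finset.prod_insert hi, Finset.sum_insert hi]
    exact (h i (by simp)).mul (ih fun j hj => h j (by simp [hj]))

/-- Cancelling the equal powers of `X` leaves `p * B = C`, so `p(0)` is an integer dividing `C(0)`.
-/
theorem HasOrder.eval_mem {p : ℤ[X]} (h : HasOrder (algebraMap ℤ[X] (RatFunc ℤ) p) 0) :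
    p.eval 0 ∈ twoFive := by
  obtain ⟨B, C, a, c, hB, hC, he, h⟩ := h
  obtain rfl : a = c := by omega
  rw [← map_mul, ← mul_assoc] at h
  have h' := mul_right_cancel₀ (pow_ne_zero a X_ne_zero) (RatFunc.algebraMap_injective ℤ h)
  refine mem_twoFive_of_dvd hC ⟨B.eval 0, ?_⟩
  rw [← h', eval_mul]

theorem HasOrder.eval_eq_zero {p : ℤ[X]} {e : ℤ} (he : 0 < e)
    (h : HasOrder (algebraMap ℤ[X] (RatFunc ℤ) p) e) : p.eval 0 = 0 := by
  obtain ⟨B, C, a, c, hB, -, he', h⟩ := h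
  obtain ⟨k, rfl⟩ : ∃ k, a = k + 1 + c := ⟨a - c - 1, by omega⟩
  rw [← map_mul, ← mul_assoc, pow_add, ← mul_assoc] at h
  have h' := congrArg (eval 0)
    (mul_right_cancel₀ (pow_ne_zero c X_ne_zero) (RatFunc.algebraMap_injective ℤ h))
  simp only [eval_mul, eval_pow, eval_X, zero_pow k.succ_ne_zero, mul_zero] at h'
  exact (mul_eq_zero.1 h').resolve_right (ne_zero_of_mem_twoFive hB)

/-- The order at `t = 0` of `pertD a`. -/
def digitOrder (a : ℕ) : ℤ := if a = 1 then 1 else if a = 2 then -1 else 0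

theorem hasOrder_pertD (k : Fin 7) : HasOrder (pertD k) (digitOrder k) := by
  have h0 := t_ne_zero
  have h2 := t_add_two_ne_zero
  have h8 := t_add_eight_ne_zero
  have h10 := t_sub_ten_ne_zero
  have e1 : 2 * t - 20 = 2 * (t - 10) := by ring
  have m2 : (2 : ℤ) ∈ twoFive := ⟨1, 0, rfl⟩
  have m4 : (4 : ℤ) ∈ twoFive := ⟨2, 0, rfl⟩
  have m4' : (-4 : ℤ) ∈ twoFive := ⟨2, 0, rfl⟩
  have m8' : (-8 : ℤ) ∈ twoFive := ⟨3, 0, rfl⟩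
  have m1' : (-1 : ℤ) ∈ twoFive := ⟨0, 0, rfl⟩
  have m10' : (-10 : ℤ) ∈ twoFive := ⟨1, 1, rfl⟩
  have m20' : (-20 : ℤ) ∈ twoFive := ⟨2, 1, rfl⟩
  have c (n : ℕ) [n.AtLeastTwo] : algebraMap ℤ[X] (RatFunc ℤ) (OfNat.ofNat n) = OfNat.ofNat n :=
    map_ofNat _ n
  fin_cases k
  · exact HasOrder.one
  · exact ⟨1, 1, 1, 0, by simp, by simp, by simp [digitOrder], by simp [pertD]⟩
  · refine ⟨1, -2 * X - 4, 0, 1, by simp, by simpa, by simp [digitOrder], ?_⟩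
    simp [pertD, c]
    field_simp
  · refine ⟨X + 2, -4, 0, 0, by simpa, by simpa, by simp [digitOrder], ?_⟩
    simp [pertD, c]
    field_simp
  · refine ⟨4, X - 10, 0, 0, by simpa, by simpa, by simp [digitOrder], ?_⟩
    simp [pertD, c]
  · refine ⟨2 * X - 20, -X - 8, 0, 0, by simpa, by simpa, by simp [digitOrder], ?_⟩
    simp [pertD, c, e1]
    field_simp
  · refine ⟨X + 8, -1, 0, 0, by simpa, by simpa, by simp [digitOrder], ?_⟩
    simp [pertD, c]
    field_simp

/-- The order at `t = 0` of the `k`-th pivot of `pertFrac`. -/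
def pivotOrder (k : ℕ) : ℤ := ((Nat.digits 7 k).map digitOrder).sum

theorem pivotOrder_zero : pivotOrder 0 = 0 := by simp [pivotOrder]

theorem pivotOrder_rec (k : ℕ) : pivotOrder k = digitOrder (k % 7) + pivotOrder (k / 7) := by
  rcases Nat.eq_zero_or_pos k with rfl | hk
  · simp [pivotOrder, digitOrder]
  · rw [pivotOrder, Nat.digits_def' (by norm_num) hk]
    simp [pivotOrder]

theorem hasOrder_finprod_pertD (k : ℕ) :
    HasOrder (∏ᶠ i : ℕ, pertD (Fin.ofNat 7 (digit 7 k i))) (pivotOrder k) := by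
  induction k using Nat.strong_induction_on with
  | _ k ih =>
    rcases Nat.eq_zero_or_pos k with rfl | hk
    · rw [finprod_digit_zero (fun n => pertD (Fin.ofNat 7 n)) rfl, pivotOrder_zero]
      exact HasOrder.one
    · rw [finprod_digit_rec (by norm_num) (fun n => pertD (Fin.ofNat 7 n)) rfl, pivotOrder_rec]
      refine HasOrder.mul ?_ (ih _ (Nat.div_lt_self hk (by norm_num)))
      simpa using hasOrder_pertD (Fin.ofNat 7 (k % 7))

/-- The order at `t = 0` of the determinant of `trunc pert n`. -/
def detOrder (n : ℕ) : ℤ := ∑ k ∈ Finset.range n, pivotOrder k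

theorem hasOrder_det_trunc_pert (n : ℕ) :
    HasOrder (algebraMap ℤ[X] (RatFunc ℤ) (trunc pert n).det) (detOrder n) := by
  rw [algebraMap_det_trunc_pert]
  exact HasOrder.prod _ fun k _ => hasOrder_finprod_pertD k

theorem detOrder_zero : detOrder 0 = 0 := rfl

theorem detOrder_succ (n : ℕ) : detOrder (n + 1) = detOrder n + pivotOrder n :=
  Finset.sum_range_succ _ _

/-- The digit orders over a full block of 7 add up to 0. In a partial block the +1 of digit 1 stays
uncompensated exactly when the block stops before digit 2, that is, for `r = 2`. -/
theorem detOrder_seven_mul_add (q r : ℕ) (hr : r < 7) :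
    detOrder (7 * q + r) =
      (7 - r) * detOrder q + r * detOrder (q + 1) + if r = 2 then 1 else 0 := by
  have h (a : ℕ) (ha : a < 7) : pivotOrder (7 * q + a) = digitOrder a + pivotOrder q := by
    rw [pivotOrder_rec]
    congr 2 <;> omega
  have h7 : detOrder (7 * q) = 7 * detOrder q := by
    rw [detOrder, sum_range_mul_eq, detOrder, Finset.mul_sum]
    refine Finset.sum_congr rfl fun k _ => ?_
    have (a : ℕ) (ha : a ∈ Finset.range 7) :
        pivotOrder (7 * k + a) = digitOrder a + pivotOrder k := by
      rw [Finset.mem_range] at ha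
      rw [pivotOrder_rec]
      congr 2 <;> omega
    rw [Finset.sum_congr rfl this]
    simp [Finset.sum_range_succ, digitOrder]
    ring
  rw [detOrder, Finset.sum_range_add, ← detOrder, h7,
    Finset.sum_congr rfl fun a ha => h a ((Finset.mem_range.1 ha).trans hr), detOrder_succ]
  interval_cases r <;> simp [Finset.sum_range_succ, digitOrder] <;> ring

theorem detOrder_nonneg (n : ℕ) : 0 ≤ detOrder n := by
  induction n using Nat.strong_induction_on with
  | _ n ih =>
    have hr := Nat.mod_lt n (show 0 < 7 by norm_num)
    rw [← Nat.div_add_mod n 7, detOrder_seven_mul_add _ _ hr]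
    -- For quotient 0 the index `n / 7 + 1` need not be below `n`, so induction is unavailable
    -- there.
    rcases Nat.eq_zero_or_pos (n / 7) with h | h
    · rw [h, zero_add, detOrder_succ, detOrder_zero, pivotOrder_zero]
      split_ifs <;> simp
    · have h1 := ih (n / 7) (by omega)
      have h2 := ih (n / 7 + 1) (by omega)
      have h3 : (0 : ℤ) ≤ 7 - (n % 7 : ℕ) := by omega
      have h4 : (0 : ℤ) ≤ if n % 7 = 2 then 1 else 0 := by split_ifs <;> simp
      positivity

/-! ### The vanishing criterion in base 7 digits -/

theorem exists_digit_iff (b n : ℕ) (P : ℕ → Prop) :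
    (∃ i, P (digit b n i)) ↔ P (n % b) ∨ ∃ i, P (digit b (n / b) i) := by
  rw [← Nat.or_exists_add_one]
  simp only [digit_zero, digit_succ]

theorem exists_lt_digit_iff (b n : ℕ) (P Q : ℕ → Prop) :
    (∃ i j, j < i ∧ P (digit b n i) ∧ Q (digit b n j)) ↔
      ((∃ i, P (digit b (n / b) i)) ∧ Q (n % b)) ∨
        ∃ i j, j < i ∧ P (digit b (n / b) i) ∧ Q (digit b (n / b) j) := by
  constructor
  · rintro ⟨_ | i, _ | j, hij, hi, hj⟩
    · omega
    · omega
    · rw [digit_succ] at hi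
      rw [digit_zero] at hj
      exact Or.inl ⟨⟨i, hi⟩, hj⟩
    · rw [digit_succ] at hi hj
      exact Or.inr ⟨i, j, by omega, hi, hj⟩
  · rintro (⟨⟨i, hi⟩, hj⟩ | ⟨i, j, hij, hi, hj⟩)
    · exact ⟨i + 1, 0, by omega, by rwa [digit_succ], by rwa [digit_zero]⟩
    · exact ⟨i + 1, j + 1, by omega, by rwa [digit_succ], by rwa [digit_succ]⟩

theorem pivotOrder_of_digit_ne_one (k : ℕ) (h : ¬ ∃ i, digit 7 k i = 1) :
    pivotOrder k ≤ 0 ∧ (pivotOrder k = 0 ↔ ¬ ∃ i, digit 7 k i = 2) := by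
  induction k using Nat.strong_induction_on with
  | _ k ih =>
    rcases Nat.eq_zero_or_pos k with rfl | hk
    · simp [pivotOrder_zero, digit]
    · rw [exists_digit_iff 7 k (· = 1)] at h
      rw [exists_digit_iff 7 k (· = 2), pivotOrder_rec]
      push Not at h
      obtain ⟨h1, h2⟩ := ih (k / 7) (Nat.div_lt_self hk (by norm_num)) (by simpa using h.2)
      rw [not_or, ← h2, digitOrder, if_neg h.1]
      split_ifs with h3 <;> constructor <;> omega

theorem detOrder_succ_eq_zero_iff (m : ℕ) :
    detOrder (m + 1) = 0 ↔ ¬ ((∃ i, digit 7 m i = 1) ∨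
      (∃ i j, j < i ∧ digit 7 m i = 2 ∧ digit 7 m j ≠ 6)) := by
  induction m using Nat.strong_induction_on with
  | _ m ih =>
    rcases Nat.eq_zero_or_pos m with rfl | hm
    · simp [detOrder_succ, detOrder_zero, pivotOrder_zero, digit]
    · have ih := ih _ (Nat.div_lt_self hm (by norm_num : 1 < 7))
      rw [exists_digit_iff 7 m (· = 1), exists_lt_digit_iff 7 m (· = 2) (· ≠ 6)]
      have hr := Nat.mod_lt m (show 0 < 7 by norm_num)
      have h0 := detOrder_nonneg (m / 7)
      have h1 := detOrder_nonneg (m / 7 + 1)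
      have h2 := pivotOrder_of_digit_ne_one (m / 7)
      have hs := detOrder_succ (m / 7)
      rcases eq_or_ne (m % 7) 6 with h6 | h6
      · have e : m + 1 = 7 * (m / 7 + 1) + 0 := by omega
        rw [e, detOrder_seven_mul_add _ _ (by norm_num), h6]
        simp only [ne_eq, not_true_eq_false, and_false, false_or] at ih ⊢
        simpa using ih
      · have e : m + 1 = 7 * (m / 7) + (m % 7 + 1) := by omega
        rw [e, detOrder_seven_mul_add _ _ (by omega)]
        -- Here `1 ≤ m % 7 + 1 ≤ 6`, so both weights are positive and each nonnegative term must
        -- vanish.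
        have h3 : (7 - ((m % 7 + 1 : ℕ) : ℤ)) * detOrder (m / 7) +
            ((m % 7 + 1 : ℕ) : ℤ) * detOrder (m / 7 + 1) + (if m % 7 + 1 = 2 then 1 else 0) = 0 ↔
            detOrder (m / 7) = 0 ∧ detOrder (m / 7 + 1) = 0 ∧ m % 7 ≠ 1 := by
          generalize detOrder (m / 7) = A at h0
          generalize detOrder (m / 7 + 1) = B at h1
          generalize m % 7 = r at hr h6
          clear * - h0 h1 hr h6
          interval_cases r <;> omega
        rw [h3]
        by_cases ho : ∃ i, digit 7 (m / 7) i = 1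
        · simp only [ho, true_or, or_true, not_true_eq_false, iff_false] at ih ⊢
          tauto
        · obtain ⟨h4, h5⟩ := h2 ho
          -- The two orders differ by `pivotOrder (m / 7)`, which, in the absence of the digit 1, is
          -- 0 exactly when no digit is 2.
          have h7 : detOrder (m / 7) = 0 ∧ detOrder (m / 7 + 1) = 0 ↔
              detOrder (m / 7 + 1) = 0 ∧ pivotOrder (m / 7) = 0 := by omega
          rw [← and_assoc, h7, ih, h5]
          simp only [h6, ho, ne_eq, not_false_eq_true, and_true, false_or, not_or]
          exact ⟨fun h => ⟨h.2, h.1.2, h.1.1⟩, fun h => ⟨⟨h.2.2, h.2.1⟩, h.1⟩⟩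

theorem det_trunc_legendrePascal_eq_zero_iff (n : ℕ) :
    (trunc (legendrePascal 7) n).det = 0 ↔ detOrder n ≠ 0 := by
  rw [det_trunc_legendrePascal]
  have h := hasOrder_det_trunc_pert n
  constructor
  · intro h0 h1
    rw [h1] at h
    exact ne_zero_of_mem_twoFive h.eval_mem h0
  · intro h0
    exact h.eval_eq_zero (lt_of_le_of_ne (detOrder_nonneg n) h0.symm)

theorem det_trunc_legendrePascal_eq (n : ℕ) :
    (trunc (legendrePascal 7) n).det = 0 ∨
      ∃ α β : ℕ, (trunc (legendrePascal 7) n).det = 2 ^ α * 5 ^ β ∨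
        (trunc (legendrePascal 7) n).det = -(2 ^ α * 5 ^ β) := by
  rcases eq_or_ne (detOrder n) 0 with h0 | h0
  · right
    have h := hasOrder_det_trunc_pert n
    rw [h0] at h
    obtain ⟨α, β, h⟩ := h.eval_mem
    rw [← det_trunc_legendrePascal] at h
    have h' := Int.natAbs_eq (trunc (legendrePascal 7) n).det
    rw [h] at h'
    push_cast at h'
    exact ⟨α, β, h'⟩
  · exact Or.inl ((det_trunc_legendrePascal_eq_zero_iff n).2 h0)

end SelfSimilar

end

theorem mainTheorem6 :
    -- the matrix of Legendre symbols modulo 7 is 7-self-similar, and degenerate even over ℚ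
    SelfSimilar.IsSelfSimilar 7 (SelfSimilar.legendrePascal 7) ∧
    ¬ SelfSimilar.IsNondegenerate 7
      ((SelfSimilar.legendrePascal 7).map (Int.cast : ℤ → ℚ)) ∧
    -- the perturbed matrix is 7-self-similar with the given defining matrix,
    -- gives back the original one at t = 0, and is nondegenerate over the field of fractions
    SelfSimilar.IsSelfSimilar 7 SelfSimilar.pert ∧
    SelfSimilar.trunc SelfSimilar.pert 7 = SelfSimilar.pertDefining ∧
    SelfSimilar.pert.map (Polynomial.eval 0) = SelfSimilar.legendrePascal 7 ∧
    SelfSimilar.IsNondegenerate 7 SelfSimilar.pertFrac ∧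
    -- the explicit factorization of the defining matrix, and the explicit d(k)
    (∀ i, SelfSimilar.pertL i i = 1) ∧
    (∀ i j, i < j → SelfSimilar.pertL i j = 0) ∧
    SelfSimilar.pertDefining.map (algebraMap (Polynomial ℤ) (RatFunc ℤ)) =
      SelfSimilar.pertL * Matrix.diagonal SelfSimilar.pertD * SelfSimilar.pertL.transpose ∧
    (∀ k : Fin 7, SelfSimilar.pivot SelfSimilar.pertFrac k = SelfSimilar.pertD k) ∧
    -- the product formula for the determinant, which is a polynomial, and its value at t = 0
    (∀ n : ℕ,
      algebraMap (Polynomial ℤ) (RatFunc ℤ) (SelfSimilar.trunc SelfSimilar.pert n).det =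
        ∏ k ∈ Finset.range n,
          ∏ᶠ i : ℕ, SelfSimilar.pertD (Fin.ofNat 7 (SelfSimilar.digit 7 k i))) ∧
    (∀ n : ℕ,
      (SelfSimilar.trunc (SelfSimilar.legendrePascal 7) n).det =
        (SelfSimilar.trunc SelfSimilar.pert n).det.eval 0) ∧
    -- the determinant is 0 or plus or minus a product of powers of 2 and 5
    (∀ n : ℕ,
      (SelfSimilar.trunc (SelfSimilar.legendrePascal 7) n).det = 0 ∨
      ∃ α β : ℕ,
        (SelfSimilar.trunc (SelfSimilar.legendrePascal 7) n).det = 2 ^ α * 5 ^ β ∨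
        (SelfSimilar.trunc (SelfSimilar.legendrePascal 7) n).det = -(2 ^ α * 5 ^ β)) ∧
    -- the vanishing criterion in terms of the base 7 digits of m = n - 1
    (∀ m : ℕ,
      (SelfSimilar.trunc (SelfSimilar.legendrePascal 7) (m + 1)).det = 0 ↔
        (∃ i, SelfSimilar.digit 7 m i = 1) ∨
        (∃ i j, j < i ∧ SelfSimilar.digit 7 m i = 2 ∧ SelfSimilar.digit 7 m j ≠ 6)) := by
  refine ⟨SelfSimilar.isSelfSimilar_legendrePascal 7,
    SelfSimilar.not_isNondegenerate_legendrePascal, SelfSimilar.isSelfSimilar_pert,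
    SelfSimilar.trunc_pert, SelfSimilar.pert_map_eval, SelfSimilar.isNondegenerate_pertFrac,
    SelfSimilar.pertL_diag, SelfSimilar.pertL_eq_zero_of_lt, SelfSimilar.pertDefining_map_eq,
    SelfSimilar.pivot_pertFrac, SelfSimilar.algebraMap_det_trunc_pert,
    SelfSimilar.det_trunc_legendrePascal, SelfSimilar.det_trunc_legendrePascal_eq, fun m => ?_⟩
  rw [SelfSimilar.det_trunc_legendrePascal_eq_zero_iff, Ne,
    SelfSimilar.detOrder_succ_eq_zero_iff, not_not]
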